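/- Let $n$ be a positive integer and let $Q\in\mathbb{C}^{n\times n}$ be an idempotent matrix ($Q^2=Q$) with $Q\neq 0_n$ and $Q\neq I_n$. A projection is a Hermitian idempotent matrix $P\in\mathbb{C}^{n\times n}$ ($P^2=P=P^*$), and $\|\cdot\|_F$ denotes the Frobenius norm. Put $$\mathrm{ran}_Q=\{\|P-Q\|_F : P\in\mathbb{C}^{n\times n}\text{ a projection}\},\qquad \mathrm{min}_Q=\inf \mathrm{ran}_Q,\qquad \mathrm{max}_Q=\sup \mathrm{ran}_Q .$$ Then $\mathrm{ran}_Q=[\mathrm{min}_Q,\mathrm{max}_Q]$. -/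

import Mathlib

noncomputable section

/-- The set of all projections (Hermitian idempotents) among the complex `n × n` matrices. -/
def projections (n : ℕ) : Set (Matrix (Fin n) (Fin n) ℂ) :=
  {P | IsStarProjection P}

open scoped Matrix.Norms.Frobenius in
/-- The Frobenius distance `‖A - B‖_F`. -/
def frobDist {m n : ℕ} (A B : Matrix (Fin m) (Fin n) ℂ) : ℝ :=
  ‖A - B‖

/-- The set of Frobenius distances from projections to `Q`. -/
def ranDist {n : ℕ} (Q : Matrix (Fin n) (Fin n) ℂ) : Set ℝ :=
  {x | ∃ P ∈ projections n, frobDist P Q = x}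

/-- The infimum of the Frobenius distances from projections to `Q`. -/
def minDist {n : ℕ} (Q : Matrix (Fin n) (Fin n) ℂ) : ℝ :=
  sInf (ranDist Q)

/-- The supremum of the Frobenius distances from projections to `Q`. -/
def maxDist {n : ℕ} (Q : Matrix (Fin n) (Fin n) ℂ) : ℝ :=
  sSup (ranDist Q)

end

open Matrix

/-! The projections form finitely many unitary orbits, one per rank. Each is a continuous image of
the compact connected unitary group, so its distances to `Q` form a compact interval. Orbits of
consecutive ranks share a distance: the squared distance is affine in `P`, and adding `v vᴴ`, for a
unit `v` orthogonal to the range of `P`, changes it by `⟨v, (1 - Q - Qᴴ) v⟩`. This form is `-1` on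
unit vectors of the range of `Q` and `1` on those of its kernel, so it vanishes somewhere in
between. Hence the intervals overlap in a chain. -/

/-- In a C⋆-algebra, a unitary on whose spectrum the argument is continuous is the exponential of
`i` times its argument. -/
theorem Unitary.expUnitary_argSelfAdjoint_of_continuousOn {A : Type*} [CStarAlgebra A]
    {u : unitary A} (harg : ContinuousOn Complex.arg (spectrum ℂ (u : A))) :
    selfAdjoint.expUnitary (Unitary.argSelfAdjoint u) = u := by
  ext
  rw [selfAdjoint.expUnitary_coe, Unitary.argSelfAdjoint_coe,
    ← CFC.exp_eq_normedSpace_exp (𝕜 := ℂ), ← cfc_comp_smul .., ← cfc_comp' ..]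
  conv_rhs => rw [← cfc_id' ℂ (u : A)]
  refine cfc_congr fun y hy ↦ ?_
  have hy₁ : ‖y‖ = 1 := spectrum.norm_eq_one_of_unitary u.2 hy
  have hlog : Complex.I * y.arg = Complex.log y :=
    Complex.ext (by simp [Complex.log_re, hy₁]) (by simp [Complex.log_im])
  have hy₀ : y ≠ 0 := by
    rintro rfl
    simp at hy₁
  simpa [← Complex.exp_eq_exp_ℂ, hlog] using Complex.exp_log hy₀

open scoped Matrix.Norms.L2Operator in
-- A finite spectrum is discrete, so `Complex.arg` is continuous on it even at the branch point
-- `-1`.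
theorem Matrix.joined_one_unitary {n : ℕ} (u : unitary (Matrix (Fin n) (Fin n) ℂ)) :
    Joined 1 u := by
  rw [← Unitary.expUnitary_argSelfAdjoint_of_continuousOn
    ((Matrix.finite_spectrum u.1).continuousOn _)]
  exact selfAdjoint.joined_one_expUnitary _

theorem Matrix.connectedSpace_unitary (n : ℕ) :
    ConnectedSpace (unitary (Matrix (Fin n) (Fin n) ℂ)) := by
  have : PathConnectedSpace (unitary (Matrix (Fin n) (Fin n) ℂ)) :=
    ⟨⟨1⟩, fun u v => (joined_one_unitary u).symm.trans (joined_one_unitary v)⟩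
  infer_instance

theorem Matrix.compactSpace_unitary (n : ℕ) :
    CompactSpace (unitary (Matrix (Fin n) (Fin n) ℂ)) := by
  refine isCompact_iff_compactSpace.mp ?_
  have hK : IsCompact (Set.univ.pi fun _ : Fin n => Set.univ.pi fun _ : Fin n =>
      Metric.closedBall (0 : ℂ) 1) :=
    isCompact_univ_pi fun _ => isCompact_univ_pi fun _ => isCompact_closedBall _ _
  refine IsCompact.of_isClosed_subset hK ?_ ?_
  · have : (unitary (Matrix (Fin n) (Fin n) ℂ) : Set (Matrix (Fin n) (Fin n) ℂ)) =
        {U | star U * U = 1} ∩ {U | U * star U = 1} := by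
      ext U
      exact Unitary.mem_iff
    rw [this]
    exact (isClosed_eq (by fun_prop) continuous_const).inter
      (isClosed_eq (by fun_prop) continuous_const)
  · intro U hU i _ j _
    simpa using entry_norm_bound_of_unitary hU i j

theorem frobDist_eq_sqrt_trace {m n : ℕ} (A B : Matrix (Fin m) (Fin n) ℂ) :
    frobDist A B = √((A - B) * (A - B)ᴴ).trace.re := by
  rw [frobDist, frobenius_norm_def, ← Real.sqrt_eq_rpow]
  congr 1
  simp only [trace, diag_apply, mul_apply, conjTranspose_apply, Complex.re_sum, Real.rpow_two]
  refine Finset.sum_congr rfl fun i _ => Finset.sum_congr rfl fun j _ => ?_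
  rw [← Complex.normSq_eq_norm_sq, Complex.star_def, Complex.mul_conj, Complex.ofReal_re]

/-- For a projection `P`, the distance to `Q` depends on `P` only through `tr (P (1 - Q - Qᴴ))`. -/
theorem frobDist_of_isStarProjection {n : ℕ} {P : Matrix (Fin n) (Fin n) ℂ}
    (hP : IsStarProjection P) (Q : Matrix (Fin n) (Fin n) ℂ) :
    frobDist P Q = √((P * (1 - Q - Qᴴ)).trace.re + (Q * Qᴴ).trace.re) := by
  have h1 : P * P = P := hP.isIdempotentElem
  have h2 : Pᴴ = P := hP.isSelfAdjoint
  rw [frobDist_eq_sqrt_trace, ← Complex.add_re]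
  congr 2
  rw [conjTranspose_sub, h2, sub_mul, mul_sub, mul_sub, h1, mul_sub, mul_sub, mul_one]
  simp only [trace_sub, trace_mul_comm Q P]
  ring

/-- The diagonal projection onto the coordinates in `S`. -/
def coordProj {n : ℕ} (S : Finset (Fin n)) : Matrix (Fin n) (Fin n) ℂ :=
  diagonal fun i => if i ∈ S then 1 else 0

theorem isStarProjection_conj_coordProj {n : ℕ} (V : unitary (Matrix (Fin n) (Fin n) ℂ))
    (S : Finset (Fin n)) :
    IsStarProjection ((V : Matrix (Fin n) (Fin n) ℂ) * coordProj S * star V.1) := by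
  have h : IsStarProjection (coordProj S) := by
    constructor
    · simp [IsIdempotentElem, coordProj]
    · rw [isSelfAdjoint_iff, star_eq_conjTranspose, coordProj, diagonal_conjTranspose]
      congr 1
      ext i
      by_cases hi : i ∈ S <;> simp [hi]
  exact h.map (Unitary.conjStarAlgAut ℂ _ V)

theorem exists_eq_conj_coordProj {n : ℕ} {P : Matrix (Fin n) (Fin n) ℂ}
    (hP : IsStarProjection P) :
    ∃ (S : Finset (Fin n)) (V : unitary (Matrix (Fin n) (Fin n) ℂ)),
      V.1 * coordProj S * star V.1 = P := by
  have hH : P.IsHermitian := hP.isSelfAdjoint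
  have hD : IsIdempotentElem (diagonal ((RCLike.ofReal : ℝ → ℂ) ∘ hH.eigenvalues)) := by
    rw [← hH.conjStarAlgAut_star_eigenvectorUnitary]
    exact hP.isIdempotentElem.map _
  refine ⟨Finset.univ.filter fun i => hH.eigenvalues i = 1, hH.eigenvectorUnitary, ?_⟩
  conv_rhs => rw [hH.spectral_theorem, Unitary.conjStarAlgAut_apply]
  congr 2
  rw [coordProj]
  congr 1
  ext i
  have hi := congrFun₂ hD.eq i i
  simp only [diagonal_mul_diagonal, diagonal_apply_eq, Function.comp_apply] at hi
  rcases IsIdempotentElem.iff_eq_zero_or_one.mp hi with h | h <;>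
  · rw [RCLike.ofReal_eq_complex_ofReal] at h
    norm_cast at h
    simp [h]

theorem exists_unitary_col {n : ℕ} {w : Fin n → ℂ} (hw : w ≠ 0) (i : Fin n) :
    ∃ (V : unitary (Matrix (Fin n) (Fin n) ℂ)) (c : ℂ), V.1.col i = c • w := by
  have hw' : WithLp.toLp 2 w ≠ 0 := by simpa using hw
  let c : ℂ := ((‖WithLp.toLp 2 w‖⁻¹ : ℝ) : ℂ)
  have ho : Orthonormal ℂ (Set.domRestrict {i} fun _ : Fin n => c • WithLp.toLp 2 w) := by
    refine ⟨fun j => ?_, fun j k hjk => (hjk (Subsingleton.elim j k)).elim⟩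
    simp [c, norm_smul, hw]
  obtain ⟨b, hb⟩ := ho.exists_orthonormalBasis_extension_of_card_eq (by simp)
  refine ⟨⟨_, (EuclideanSpace.basisFun (Fin n) ℂ).toMatrix_orthonormalBasis_mem_unitary b⟩, c, ?_⟩
  ext j
  have := hb i rfl
  simp [Module.Basis.toMatrix_apply, this]

theorem conj_apply_diag {n : ℕ} (V H : Matrix (Fin n) (Fin n) ℂ) (i : Fin n) :
    (star V * H * V) i i = star (V.col i) ⬝ᵥ H *ᵥ V.col i := by
  rw [mul_assoc]
  simp [mul_apply, dotProduct, mulVec, star_eq_conjTranspose]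

theorem col_dotProduct_self {n : ℕ} (V : unitary (Matrix (Fin n) (Fin n) ℂ)) (i : Fin n) :
    star (V.1.col i) ⬝ᵥ V.1.col i = 1 := by
  have := conj_apply_diag V.1 1 i
  rw [mul_one, Unitary.coe_star_mul_self, one_apply_eq, one_mulVec] at this
  exact this.symm

/-- If `v` is an eigenvector of `Q`, the quadratic form of `1 - Q - Qᴴ` at the unit vector `v` is
determined by the eigenvalue. -/
theorem conj_apply_diag_of_mulVec_col {n : ℕ} {Q : Matrix (Fin n) (Fin n) ℂ}
    {V : unitary (Matrix (Fin n) (Fin n) ℂ)} {i : Fin n} {μ : ℂ}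
    (h : Q *ᵥ V.1.col i = μ • V.1.col i) :
    (star V.1 * (1 - Q - Qᴴ) * V.1) i i = 1 - μ - star μ := by
  have hc := col_dotProduct_self V i
  rw [conj_apply_diag, sub_mulVec, sub_mulVec, one_mulVec, dotProduct_sub, dotProduct_sub,
    dotProduct_mulVec _ Qᴴ, ← star_mulVec, h, star_smul, smul_dotProduct, dotProduct_smul, hc]
  simp

/-- A nontrivial idempotent admits an orthonormal frame whose `i`-th vector is isotropic for
`1 - Q - Qᴴ`. -/
theorem exists_unitary_diag_eq_zero {n : ℕ} {Q : Matrix (Fin n) (Fin n) ℂ}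
    (hQ : IsIdempotentElem Q) (hQ0 : Q ≠ 0) (hQ1 : Q ≠ 1) (i : Fin n) :
    ∃ V : unitary (Matrix (Fin n) (Fin n) ℂ), ((star V.1 * (1 - Q - Qᴴ) * V.1) i i).re = 0 := by
  have := connectedSpace_unitary n
  have hcont : Continuous fun V : unitary (Matrix (Fin n) (Fin n) ℂ) =>
      ((star V.1 * (1 - Q - Qᴴ) * V.1) i i).re :=
    Complex.continuous_re.comp (Continuous.matrix_elem (by fun_prop) i i)
  have key : ∀ A : Matrix (Fin n) (Fin n) ℂ, A ≠ 0 → ∀ μ : ℂ, Q * A = μ • A →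
      ∃ V : unitary (Matrix (Fin n) (Fin n) ℂ),
        (star V.1 * (1 - Q - Qᴴ) * V.1) i i = 1 - μ - star μ := by
    intro A hA μ hQA
    obtain ⟨x, hx⟩ : ∃ x, A *ᵥ x ≠ 0 := by
      by_contra! h
      exact hA (ext_of_mulVec_single fun j => by rw [h, zero_mulVec])
    obtain ⟨V, c, hV⟩ := exists_unitary_col hx i
    refine ⟨V, conj_apply_diag_of_mulVec_col ?_⟩
    rw [hV, mulVec_smul, mulVec_mulVec, hQA, smul_mulVec, smul_comm]
  -- Columns of `Q` have eigenvalue `1`, those of `1 - Q` eigenvalue `0`: the diagonal entry takes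
  -- the values `-1` and `1`.
  obtain ⟨V, hV⟩ := key Q hQ0 1 (by rw [hQ.eq, one_smul])
  obtain ⟨W, hW⟩ := key (1 - Q) (sub_ne_zero.mpr hQ1.symm) 0 (by simp [mul_sub, hQ.eq])
  refine mem_range_of_exists_le_of_exists_ge hcont ⟨V, ?_⟩ ⟨W, ?_⟩
  · rw [hV]; norm_num
  · rw [hW]; norm_num

/-- Distances to `Q` of the projections unitarily equivalent to `coordProj S`. -/
def orbitDist {n : ℕ} (Q : Matrix (Fin n) (Fin n) ℂ) (S : Finset (Fin n)) : Set ℝ :=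
  Set.range fun V : unitary (Matrix (Fin n) (Fin n) ℂ) =>
    frobDist (V.1 * coordProj S * star V.1) Q

theorem continuous_frobDist_conj {n : ℕ} (Q D : Matrix (Fin n) (Fin n) ℂ) :
    Continuous fun V : unitary (Matrix (Fin n) (Fin n) ℂ) => frobDist (V.1 * D * star V.1) Q := by
  simp only [frobDist_eq_sqrt_trace]
  exact (Complex.continuous_re.comp (Continuous.matrix_trace (by fun_prop))).sqrt

theorem ranDist_eq_iUnion_orbitDist {n : ℕ} (Q : Matrix (Fin n) (Fin n) ℂ) :
    ranDist Q = ⋃ S, orbitDist Q S := by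
  ext x
  simp only [ranDist, orbitDist, Set.mem_iUnion, Set.mem_range]
  constructor
  · rintro ⟨P, hP, rfl⟩
    obtain ⟨S, V, rfl⟩ := exists_eq_conj_coordProj hP
    exact ⟨S, V, rfl⟩
  · rintro ⟨S, V, rfl⟩
    exact ⟨_, isStarProjection_conj_coordProj V S, rfl⟩

/-- The same `V` serves both orbits: its isotropic `i`-th column spans the extra rank-one summand,
which contributes nothing to the trace. -/
theorem orbitDist_inter_insert_nonempty {n : ℕ} {Q : Matrix (Fin n) (Fin n) ℂ}
    (hQ : IsIdempotentElem Q) (hQ0 : Q ≠ 0) (hQ1 : Q ≠ 1) {i : Fin n} {S : Finset (Fin n)}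
    (hi : i ∉ S) : (orbitDist Q S ∩ orbitDist Q (insert i S)).Nonempty := by
  obtain ⟨V, hV⟩ := exists_unitary_diag_eq_zero hQ hQ0 hQ1 i
  refine ⟨_, ⟨V, rfl⟩, V, ?_⟩
  have hins : coordProj (insert i S) = coordProj S + single i i 1 := by
    rw [coordProj, coordProj, ← diagonal_single, diagonal_add]
    congr 1
    ext j
    by_cases hj : j = i
    · subst hj; simp [hi]
    · simp [hj]
  have htr : (V.1 * single i i 1 * star V.1 * (1 - Q - Qᴴ)).trace.re = 0 := by
    rw [mul_assoc, mul_assoc, trace_mul_comm, mul_assoc, mul_assoc, trace_single_mul,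
      ← mul_assoc, one_smul, hV]
  simp only [frobDist_of_isStarProjection (isStarProjection_conj_coordProj V _)]
  rw [hins, mul_add, add_mul, add_mul, trace_add, Complex.add_re, htr, add_zero]

theorem isConnected_ranDist {n : ℕ} {Q : Matrix (Fin n) (Fin n) ℂ}
    (hQ : IsIdempotentElem Q) (hQ0 : Q ≠ 0) (hQ1 : Q ≠ 1) : IsConnected (ranDist Q) := by
  have := connectedSpace_unitary n
  rw [ranDist_eq_iUnion_orbitDist]
  let r : Finset (Fin n) → Finset (Fin n) → Prop :=
    fun S T => (orbitDist Q S ∩ orbitDist Q T).Nonempty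
  have hsymm : Std.Symm r := ⟨fun _ _ ⟨x, hS, hT⟩ => ⟨x, hT, hS⟩⟩
  -- Every orbit is linked to that of the zero projection by adding one coordinate at a time.
  have hempty (S : Finset (Fin n)) : Relation.ReflTransGen r ∅ S := by
    induction S using Finset.induction_on with
    | empty => exact .refl
    | insert i S hi ih => exact ih.tail (orbitDist_inter_insert_nonempty hQ hQ0 hQ1 hi)
  exact IsConnected.iUnion_of_reflTransGen
    (fun S => isConnected_range (continuous_frobDist_conj Q _))
    fun S T => (Std.Symm.symm _ _ (hempty S)).trans (hempty T)

theorem isCompact_ranDist {n : ℕ} (Q : Matrix (Fin n) (Fin n) ℂ) : IsCompact (ranDist Q) := by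
  have := compactSpace_unitary n
  rw [ranDist_eq_iUnion_orbitDist]
  exact isCompact_iUnion fun S => isCompact_range (continuous_frobDist_conj Q _)

theorem theorem4p3 {n : ℕ} (Q : Matrix (Fin n) (Fin n) ℂ) (hQ : IsIdempotentElem Q)
    (hQ0 : Q ≠ 0) (hQ1 : Q ≠ 1) :
    ranDist Q = Set.Icc (minDist Q) (maxDist Q) :=
  eq_Icc_of_connected_compact (isConnected_ranDist hQ hQ0 hQ1) (isCompact_ranDist Q)
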